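/- Let $\mathbb S=\langle\{0,h,1\};+,\cdot,0,1\rangle$ be the three-element commutative semiring in which $0$ is neutral for $+$, $h+h=h$, $h+1=1+h=1$, $1+1=h$, and $\cdot$ is the minimum for $0<h<1$ (the subsemiring $\{(0,0),(0,1),(1,1)\}$ of the product of the two-element field and the two-element lattice). Let $$r_1=S^2\setminus\{(1,0)\},\quad r_2=S^2\setminus\{(h,0),(1,0)\},\quad r_3=S^2\setminus\{(0,1),(h,1),(1,0),(1,h)\},$$ and let $\underset{\sim}{S}=\langle S;\{r_1,r_2,r_3\},\mathcal T\rangle$ with $\mathcal T$ the discrete topology. Let $\mathcal A=ISP(\mathbb S)$ be the class of semirings isomorphic to subsemirings of powers of $\mathbb S$, with the semiring homomorphisms, and let $\chi=IS_cP^+(\underset{\sim}{S})$ be the class of topological structures isomorphic to (possibly empty) closed substructures of powers of $\underset{\sim}{S}$ with non-empty exponent, with the continuous relation-preserving maps. For $A\in\mathcal A$ and $X\in\chi$ let $D(A)=\mathcal A(A,\mathbb S)$, as a substructure of $\underset{\sim}{S}^A$, and $E(X)=\chi(X,\underset{\sim}{S})$, as a subsemiring of $\mathbb S^X$, with evaluation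 maps $e_A:A\to ED(A)$ and $\varepsilon_X:X\to DE(X)$. One says that $\underset{\sim}{S}$ yields a duality on $\mathcal A$ if $e_A$ is an isomorphism for every $A\in\mathcal A$; a full duality if moreover $\varepsilon_X$ is an isomorphism for every $X\in\chi$; and a strong duality if it yields a full duality and is injective in $\chi$, i.e. morphisms $X\to\underset{\sim}{S}$ extend along every embedding $X\to Y$ (as a closed substructure) in $\chi$. **Theorem 4.1.** $\underset{\sim}{S}$ yields a duality on $\mathcal A$ and is injective in $\chi$, but this duality is neither full nor strong; indeed some $X\in\chi$ is not isomorphic to $DE(X)$ by any map. Moreover, the finite term closure condition (for all $n$, $X\subseteq S^n$ and $y\in S^n\setminus X$ there are $n$-ary term functions $\sigma,\tau$ of $\mathbb S$ that agree on $X$ but not at $y$) fails, namely for $n=1$, $X=\{0,1\}$ and $y=h$. -/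

import Mathlib

universe u v

namespace BoolSR

/-! ### The three-element Boolean semiring -/

/-- The carrier `{0, h, 1}`. -/
inductive S3 : Type
  | zero
  | half
  | one
  deriving DecidableEq

namespace S3

instance : Fintype S3 := ⟨{zero, half, one}, by intro x; cases x <;> decide⟩

/-- Addition: `0` is neutral, `h + h = h`, `h + 1 = 1`, `1 + 1 = h`. -/
def add : S3 → S3 → S3
  | zero, y => y
  | half, zero => half
  | half, half => half
  | half, one => one
  | one, zero => one
  | one, half => one
  | one, one => half

/-- Multiplication: the minimum for the order `0 < h < 1`. -/
def mul : S3 → S3 → S3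
  | zero, _ => zero
  | half, zero => zero
  | half, half => half
  | half, one => half
  | one, y => y

instance : Zero S3 := ⟨zero⟩

instance : One S3 := ⟨one⟩

instance : Add S3 := ⟨add⟩

instance : Mul S3 := ⟨mul⟩

/-- The semiring on `{0, h, 1}`.  It is the subsemiring `{(0,0), (0,1), (1,1)}` of the product of
the two two-element semirings (the field with `1 + 1 = 0`, and the lattice with `1 + 1 = 1`),
where `h = (0,1) = 1 + 1`. -/
instance : CommSemiring S3 where
  nsmul := nsmulRec
  add_assoc := by intro a b c; cases a <;> cases b <;> cases c <;> rfl
  zero_add := by intro a; cases a <;> rfl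
  add_zero := by intro a; cases a <;> rfl
  add_comm := by intro a b; cases a <;> cases b <;> rfl
  mul_assoc := by intro a b c; cases a <;> cases b <;> cases c <;> rfl
  one_mul := by intro a; cases a <;> rfl
  mul_one := by intro a; cases a <;> rfl
  mul_comm := by intro a b; cases a <;> cases b <;> rfl
  zero_mul := by intro a; cases a <;> rfl
  mul_zero := by intro a; cases a <;> rfl
  left_distrib := by intro a b c; cases a <;> cases b <;> cases c <;> rfl
  right_distrib := by intro a b c; cases a <;> cases b <;> cases c <;> rfl

/-- The discrete topology. -/
instance : TopologicalSpace S3 := ⊥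

instance : DiscreteTopology S3 := ⟨rfl⟩

end S3

/-- `r₁ = S² ∖ {(1,0)}`. -/
def r1 : Set (S3 × S3) := {(.one, .zero)}ᶜ

/-- `r₂ = S² ∖ {(h,0), (1,0)}`. -/
def r2 : Set (S3 × S3) := {(.half, .zero), (.one, .zero)}ᶜ

/-- `r₃ = S² ∖ {(0,1), (h,1), (1,0), (1,h)}`. -/
def r3 : Set (S3 × S3) := {(.zero, .one), (.half, .one), (.one, .zero), (.one, .half)}ᶜ

/-! ### Topological structures with three binary relations -/

/-- Three binary relations on `X`. -/
class TriRel (X : Type u) where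
  rel : Fin 3 → X → X → Prop

/-- With its discrete topology, `S3` carries the structure `⟨S; {r₁, r₂, r₃}, 𝒯⟩`. -/
instance : TriRel S3 where
  rel i x y := (x, y) ∈ ![r1, r2, r3] i

/-- Relations on a power are defined pointwise; the topology is the product topology. -/
instance {ι : Type v} : TriRel (ι → S3) where
  rel i x y := ∀ j, TriRel.rel i (x j) (y j)

section Category

variable {X : Type u} {Y : Type v} [TopologicalSpace X] [TriRel X] [TopologicalSpace Y] [TriRel Y]

/-- Morphisms: continuous maps that preserve the relations. -/
def IsMorphism (f : X → Y) : Prop :=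
  Continuous f ∧ ∀ i x y, TriRel.rel i x y → TriRel.rel i (f x) (f y)

/-- Embeddings: isomorphisms onto a topologically closed substructure. -/
def IsStrEmbedding (f : X → Y) : Prop :=
  Topology.IsClosedEmbedding f ∧ ∀ i x y, TriRel.rel i x y ↔ TriRel.rel i (f x) (f y)

/-- Isomorphisms of topological structures. -/
def IsStrIso (f : X → Y) : Prop :=
  IsHomeomorph f ∧ ∀ i x y, TriRel.rel i x y ↔ TriRel.rel i (f x) (f y)

end Category

/-- `X` is an object of `χ = IS_cP⁺(⟨S; {r₁, r₂, r₃}, 𝒯⟩)`: it is isomorphic to a (possibly empty)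
topologically closed substructure of a power with nonempty exponent. -/
def InChi (X : Type u) [TopologicalSpace X] [TriRel X] : Prop :=
  ∃ ι : Type u, Nonempty ι ∧ ∃ f : X → (ι → S3), IsStrEmbedding f

/-- `A` is an object of the quasi-variety `𝒜 = ISP(S)`: it is isomorphic to a subsemiring of a power
of `S` (the exponent may be empty, so that the one-element semiring belongs to `𝒜`). -/
def InISP (A : Type u) [Semiring A] : Prop :=
  ∃ ι : Type u, ∃ f : A →+* (ι → S3), Function.Injective f

/-! ### The hom-functors and the two evaluation maps -/

theorem rel_zero (i : Fin 3) : TriRel.rel i (0 : S3) 0 := by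
  change ((S3.zero, S3.zero) : S3 × S3) ∈ ![r1, r2, r3] i
  fin_cases i <;> simp [r1, r2, r3]

theorem rel_one (i : Fin 3) : TriRel.rel i (1 : S3) 1 := by
  change ((S3.one, S3.one) : S3 × S3) ∈ ![r1, r2, r3] i
  fin_cases i <;> simp [r1, r2, r3]

theorem rel_add (i : Fin 3) {a b c d : S3} (h : TriRel.rel i a b) (h' : TriRel.rel i c d) :
    TriRel.rel i (a + c) (b + d) := by
  change (S3.add a c, S3.add b d) ∈ ![r1, r2, r3] i
  change (a, b) ∈ ![r1, r2, r3] i at h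
  change (c, d) ∈ ![r1, r2, r3] i at h'
  fin_cases i <;> cases a <;> cases b <;> cases c <;> cases d <;>
    simp_all [r1, r2, r3, S3.add]

theorem rel_mul (i : Fin 3) {a b c d : S3} (h : TriRel.rel i a b) (h' : TriRel.rel i c d) :
    TriRel.rel i (a * c) (b * d) := by
  change (S3.mul a c, S3.mul b d) ∈ ![r1, r2, r3] i
  change (a, b) ∈ ![r1, r2, r3] i at h
  change (c, d) ∈ ![r1, r2, r3] i at h'
  fin_cases i <;> cases a <;> cases b <;> cases c <;> cases d <;>
    simp_all [r1, r2, r3, S3.mul]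

/-- `E(X) = χ(X, S)`, as a subsemiring of the power `S^X`. -/
def E (X : Type u) [TopologicalSpace X] [TriRel X] : Subsemiring (X → S3) where
  carrier := {α | IsMorphism α}
  zero_mem' := ⟨continuous_const, fun i _ _ _ => rel_zero i⟩
  one_mem' := ⟨continuous_const, fun i _ _ _ => rel_one i⟩
  add_mem' := fun ha hb =>
    ⟨ha.1.add hb.1, fun i x y h => rel_add i (ha.2 i x y h) (hb.2 i x y h)⟩
  mul_mem' := fun ha hb =>
    ⟨ha.1.mul hb.1, fun i x y h => rel_mul i (ha.2 i x y h) (hb.2 i x y h)⟩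

/-- `D(A) = 𝒜(A, S)`, the set of semiring homomorphisms (preserving `0` and `1`). -/
def D (A : Type u) [Semiring A] : Type u := A →+* S3

/-- `D(A)` carries the topology of a subspace of the power `S^A`. -/
instance (A : Type u) [Semiring A] : TopologicalSpace (D A) :=
  TopologicalSpace.induced (fun (x : A →+* S3) (a : A) => x a) inferInstance

/-- `D(A)` carries the relations of a substructure of the power `S^A`. -/
instance (A : Type u) [Semiring A] : TriRel (D A) where
  rel i (x y : A →+* S3) := TriRel.rel i (fun a => x a) (fun a => y a)

/-- The unit `e_A : A → ED(A)`, `e_A(a)(x) = x(a)`. -/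
def e (A : Type u) [Semiring A] : A →+* E (D A) where
  toFun a := ⟨fun (x : A →+* S3) => x a,
    (continuous_apply a).comp continuous_induced_dom, fun _ _ _ h => h a⟩
  map_zero' := Subtype.ext (funext fun (x : A →+* S3) => map_zero x)
  map_one' := Subtype.ext (funext fun (x : A →+* S3) => map_one x)
  map_add' a b := Subtype.ext (funext fun (x : A →+* S3) => map_add x a b)
  map_mul' a b := Subtype.ext (funext fun (x : A →+* S3) => map_mul x a b)

/-- The counit `ε_X : X → DE(X)`, `ε_X(x)(α) = α(x)`. -/
def eps (X : Type u) [TopologicalSpace X] [TriRel X] (x : X) : D (E X) :=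
  ((Pi.evalRingHom (fun _ : X => S3) x).comp (E X).subtype : E X →+* S3)

/-! ### Dualities -/

/-- `⟨S; {r₁, r₂, r₃}, 𝒯⟩` yields a (natural) duality on `𝒜`. -/
def YieldsDuality : Prop :=
  ∀ (A : Type u) [Semiring A], InISP A → Function.Bijective (e A)

/-- `⟨S; {r₁, r₂, r₃}, 𝒯⟩` yields a full duality on `𝒜`. -/
def YieldsFullDuality : Prop :=
  YieldsDuality.{u} ∧ ∀ (X : Type u) [TopologicalSpace X] [TriRel X], InChi X → IsStrIso (eps X)

/-- `⟨S; {r₁, r₂, r₃}, 𝒯⟩` is injective in `χ`: morphisms into it extend along embeddings. -/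
def InjectiveInChi : Prop :=
  ∀ (X Y : Type u) [TopologicalSpace X] [TriRel X] [TopologicalSpace Y] [TriRel Y],
    InChi X → InChi Y → ∀ φ : X → Y, IsStrEmbedding φ →
      ∀ α : X → S3, IsMorphism α → ∃ β : Y → S3, IsMorphism β ∧ β ∘ φ = α

/-- `⟨S; {r₁, r₂, r₃}, 𝒯⟩` yields a strong duality on `𝒜`. -/
def YieldsStrongDuality : Prop :=
  YieldsFullDuality.{u} ∧ InjectiveInChi.{u}

/-! ### Finite term closure -/

/-- The `n`-ary term functions of the semiring `S`: the functions `Sⁿ → S` generated from the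
projections by `0`, `1`, `+` and `·`. -/
def termFunctions (n : ℕ) : Subsemiring ((Fin n → S3) → S3) :=
  Subsemiring.closure (Set.range fun (k : Fin n) (x : Fin n → S3) => x k)

/-- Some two `n`-ary term functions agree on `X` but not at `y`. -/
def TermSeparates {n : ℕ} (X : Set (Fin n → S3)) (y : Fin n → S3) : Prop :=
  ∃ σ ∈ termFunctions n, ∃ τ ∈ termFunctions n, Set.EqOn σ τ X ∧ σ y ≠ τ y

/-- The finite term closure condition.  As there are no operations in the structure and `Sⁿ` is
discrete, every subset of `Sⁿ` is a closed substructure. -/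
def FiniteTermClosure : Prop :=
  ∀ (n : ℕ) (X : Set (Fin n → S3)) (y : Fin n → S3), y ∉ X → TermSeparates X y

end BoolSR

namespace BoolSR

/-! ### Interpolation on compact spaces -/

/-! Duality and injectivity are one interpolation fact on a compact space. Write elements of `S3` as
pairs (field component, lattice component). A continuous `α` equals `b + b + c` once `b` vanishes
exactly where `α` does, `c = 1` exactly where `α = 1`, and `c = 0` wherever `α = 0`. Compactness
builds `b` and `c` inside a subsemiring `T` from members that separate pairs of points, and the
pairs needed are just those that violate `r1`, `r2` or `r3`. Hence `T` contains every morphism as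
soon as it witnesses each failure of a relation (`IsMorphism.mem_of_reflects`). For duality `T`
consists of the evaluations at elements of `A`; for injectivity, of the restrictions of morphisms
from the larger structure.

Fullness fails at `{0, 1}`. The relation `r1` forbids only the values for which the field component
at `0` and the lattice component at `1` do not form an element of `S3`. Gluing these components is
therefore a third homomorphism on the dual of a two-point structure. The same gluing computes `σ(h)`
for every unary term function `σ`, so term closure fails too. -/

theorem S3.isClopen_preimage {X : Type*} [TopologicalSpace X] {f : X → S3} (hf : Continuous f)
    (s : Set S3) : IsClopen (f ⁻¹' s) :=
  (isClopen_discrete s).preimage hf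

theorem S3.add_eq_zero_iff (a b : S3) : a + b = 0 ↔ a = 0 ∧ b = 0 := by
  revert a b; decide

theorem S3.mul_ne_zero_iff (a b : S3) : a * b ≠ 0 ↔ a ≠ 0 ∧ b ≠ 0 := by
  revert a b; decide

theorem S3.mul_eq_one_iff (a b : S3) : a * b = 1 ↔ a = 1 ∧ b = 1 := by
  revert a b; decide

theorem S3.add_add_mul_eq_one_iff (a b : S3) : a + b + a * b = 1 ↔ a = 1 ∨ b = 1 := by
  revert a b; decide

theorem S3.one_add_eq_one_iff (a : S3) : 1 + a = 1 ↔ a ≠ 1 := by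
  revert a; decide

theorem S3.mem_rel_zero_iff (a b : S3) : TriRel.rel 0 a b ↔ ¬ (a = 1 ∧ b = 0) := by
  change (a, b) ∈ r1 ↔ _
  cases a <;> cases b <;> simp [r1, show (0 : S3) = .zero from rfl, show (1 : S3) = .one from rfl]

theorem S3.mem_rel_one_iff (a b : S3) : TriRel.rel 1 a b ↔ ¬ (a ≠ 0 ∧ b = 0) := by
  change (a, b) ∈ r2 ↔ _
  cases a <;> cases b <;> simp [r2, show (0 : S3) = .zero from rfl]

theorem S3.mem_rel_two_iff (a b : S3) : TriRel.rel 2 a b ↔ (a = 1 ↔ b = 1) := by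
  change (a, b) ∈ r3 ↔ _
  cases a <;> cases b <;> simp [r3, show (1 : S3) = .one from rfl]

section Interpolation

variable {X : Type*} [TopologicalSpace X] [CompactSpace X]

/-- Let `op` be a binary operation on a set `T` of continuous functions such that `op s t` takes
values in `p` wherever `s` or `t` does.  If each point of a closed set `K` has a member of `T` with
value in `p` there, then some member of `T` maps all of `K` into `p`. -/
theorem exists_mem_forall_of_isClosed (T : Set (X → S3)) (hcont : ∀ t ∈ T, Continuous t)
    (op : (X → S3) → (X → S3) → X → S3) (p : Set S3) {K : Set X} (hK : IsClosed K)
    (e : X → S3) (he : e ∈ T) (hop : ∀ s ∈ T, ∀ t ∈ T, op s t ∈ T)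
    (hleft : ∀ s t x, s x ∈ p → op s t x ∈ p) (hright : ∀ s t x, t x ∈ p → op s t x ∈ p)
    (h : ∀ x ∈ K, ∃ t ∈ T, t x ∈ p) : ∃ t ∈ T, ∀ x ∈ K, t x ∈ p := by
  -- Being served by a single member of `T` is local and passes to finite unions through `op`; `e`
  -- serves the empty set.
  refine hK.isCompact.induction_on (p := fun K => ∃ t ∈ T, ∀ x ∈ K, t x ∈ p)
    ⟨e, he, by simp⟩ ?_ ?_ ?_
  · rintro s s' hss ⟨t, ht, h'⟩
    exact ⟨t, ht, fun x hx => h' x (hss hx)⟩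
  · rintro s s' ⟨t, ht, h1⟩ ⟨t', ht', h2⟩
    refine ⟨op t t', hop t ht t' ht', fun x hx => ?_⟩
    rcases hx with hx | hx
    · exact hleft _ _ _ (h1 x hx)
    · exact hright _ _ _ (h2 x hx)
  · intro x hx
    obtain ⟨t, ht, htx⟩ := h x hx
    exact ⟨t ⁻¹' p, mem_nhdsWithin_of_mem_nhds
      ((S3.isClopen_preimage (hcont t ht) p).isOpen.mem_nhds htx), t, ht, fun _ hy => hy⟩

/-- A subsemiring of continuous functions into `S` on a compact space contains every continuous
function whose relevant pairs of values it separates. -/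
theorem mem_of_separates_pairs (T : Subsemiring (X → S3)) (hcont : ∀ t ∈ T, Continuous t)
    {α : X → S3} (hα : Continuous α)
    (h1 : ∀ x y, α x = 1 → α y = 0 → ∃ t ∈ T, t x = 1 ∧ t y = 0)
    (h2 : ∀ x y, α x ≠ 0 → α y = 0 → ∃ t ∈ T, t x ≠ 0 ∧ t y = 0)
    (h3 : ∀ x y, α x = 1 → α y ≠ 1 → ∃ t ∈ T, t x = 1 ∧ t y ≠ 1) : α ∈ T := by
  have closed (s : Set S3) : IsClosed (α ⁻¹' s) := (S3.isClopen_preimage hα s).isClosed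
  -- multiplying, one separates a point from a closed set
  have sep (r q : Set S3) (K : Set X) (hK : IsClosed K) (x : X) (hr1 : (1 : S3) ∈ r)
      (hr : ∀ a ∈ r, ∀ b ∈ r, a * b ∈ r) (hq : ∀ a b : S3, a ∈ q → a * b ∈ q)
      (h : ∀ y ∈ K, ∃ t ∈ T, t x ∈ r ∧ t y ∈ q) :
      ∃ t ∈ T, t x ∈ r ∧ ∀ y ∈ K, t y ∈ q := by
    obtain ⟨t, ht, htq⟩ := exists_mem_forall_of_isClosed {t | t ∈ T ∧ t x ∈ r}
      (fun t ht => hcont t ht.1) (fun s t => s * t) q hK 1 ⟨one_mem T, hr1⟩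
      (fun s hs t ht => ⟨mul_mem hs.1 ht.1, hr _ hs.2 _ ht.2⟩)
      (fun s t x hs => hq _ _ hs)
      (fun s t x ht => by
        change s x * t x ∈ q
        rw [mul_comm]
        exact hq _ _ ht)
      (fun y hy => (h y hy).imp fun t ht => ⟨⟨ht.1, ht.2.1⟩, ht.2.2⟩)
    exact ⟨t, ht.1, ht.2, htq⟩
  -- `b` has the same zero set as `α`: a sum vanishes only if both summands do, so sums accumulate
  -- the support.
  obtain ⟨b, hb, hbV⟩ := exists_mem_forall_of_isClosed {t | t ∈ T ∧ ∀ y, α y = 0 → t y = 0}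
    (fun t ht => hcont t ht.1) (fun s t => s + t) {0}ᶜ (closed {0}ᶜ) 0
    ⟨zero_mem T, fun _ _ => rfl⟩
    (fun s hs t ht => ⟨add_mem hs.1 ht.1, fun y hy =>
      (S3.add_eq_zero_iff _ _).2 ⟨hs.2 y hy, ht.2 y hy⟩⟩)
    (fun s t x hs h => hs ((S3.add_eq_zero_iff _ _).1 h).1)
    (fun s t x ht h => ht ((S3.add_eq_zero_iff _ _).1 h).2)
    (fun x hx => by
      obtain ⟨t, ht, htx, hty⟩ := sep {0}ᶜ {0} (α ⁻¹' {0}) (closed _) x (by decide)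
        (fun a ha b hb => (S3.mul_ne_zero_iff a b).2 ⟨ha, hb⟩)
        (fun a b ha => by rw [Set.mem_singleton_iff.1 ha, zero_mul]; rfl)
        (fun y hy => h2 x y hx hy)
      exact ⟨t, ⟨ht, hty⟩, htx⟩)
  -- `c` takes the value `1` exactly where `α` does. The operation `s + t + s * t` is disjunction in
  -- the field component, and `1` is the only element whose field component is nonzero.
  obtain ⟨c, hc, hcU⟩ := exists_mem_forall_of_isClosed
    {t | t ∈ T ∧ (∀ y, α y = 0 → t y = 0) ∧ ∀ y, α y ≠ 1 → t y ≠ 1}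
    (fun t ht => hcont t ht.1) (fun s t => s + t + s * t) {1} (closed {1}) 0
    ⟨zero_mem T, fun _ _ => rfl, fun _ _ => (by decide : (0 : S3) ≠ 1)⟩
    (fun s hs t ht => ⟨add_mem (add_mem hs.1 ht.1) (mul_mem hs.1 ht.1), fun y hy => by
        change s y + t y + s y * t y = 0
        rw [hs.2.1 y hy, ht.2.1 y hy]
        rfl,
      fun y hy h => ((S3.add_add_mul_eq_one_iff _ _).1 h).elim (hs.2.2 y hy) (ht.2.2 y hy)⟩)
    (fun s t x hs => (S3.add_add_mul_eq_one_iff _ _).2 (Or.inl hs))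
    (fun s t x ht => (S3.add_add_mul_eq_one_iff _ _).2 (Or.inr ht))
    (fun x hx => by
      have mul_one_mem : ∀ a ∈ ({1} : Set S3), ∀ b ∈ ({1} : Set S3), a * b ∈ ({1} : Set S3) :=
        fun a ha b hb => (S3.mul_eq_one_iff a b).2 ⟨ha, hb⟩
      obtain ⟨t, ht, htx, hty⟩ := sep {1} {0} (α ⁻¹' {0}) (closed _) x rfl mul_one_mem
        (fun a b ha => by rw [Set.mem_singleton_iff.1 ha, zero_mul]; rfl)
        (fun y hy => h1 x y hx hy)
      obtain ⟨t', ht', htx', hty'⟩ := sep {1} {1}ᶜ (α ⁻¹' {1}ᶜ) (closed _) x rfl mul_one_mem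
        (fun a b ha h => ha ((S3.mul_eq_one_iff a b).1 h).1)
        (fun y hy => h3 x y hx hy)
      refine ⟨t * t', ⟨mul_mem ht ht', fun y hy => ?_, fun y hy h => ?_⟩,
        mul_one_mem _ htx _ htx'⟩
      · change t y * t' y = 0
        rw [hty y hy, zero_mul]
      · exact hty' y hy ((S3.mul_eq_one_iff _ _).1 h).2)
  -- `b + b` is `h` on the support of `α` and `0` elsewhere; adding `c` raises `h` to `1` exactly
  -- where `c = 1`, and `h + h = h` absorbs the other values of `c`.
  have key : α = b + b + c := by
    funext x
    have hb0 := hb.2 x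
    have hb1 : α x ≠ 0 → b x ≠ 0 := hbV x
    have hc0 := hc.2.1 x
    have hc1 := hc.2.2 x
    have hc2 : α x = 1 → c x = 1 := hcU x
    change α x = b x + b x + c x
    generalize α x = a, b x = b', c x = c' at *
    revert a b' c'
    decide
  rw [key]
  exact add_mem (add_mem hb.1 hb.1) hc.1

/-- A subsemiring of continuous functions into `S` on a compact structure that witnesses every
failure of one of the relations contains all morphisms. -/
theorem IsMorphism.mem_of_reflects [TriRel X] (T : Subsemiring (X → S3))
    (hcont : ∀ t ∈ T, Continuous t)
    (hrel : ∀ i x y, ¬ TriRel.rel i x y → ∃ t ∈ T, ¬ TriRel.rel i (t x) (t y))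
    {α : X → S3} (hα : IsMorphism α) : α ∈ T := by
  have wit (i : Fin 3) (x y : X) (h : ¬ TriRel.rel i (α x) (α y)) :
      ∃ t ∈ T, ¬ TriRel.rel i (t x) (t y) := hrel i x y fun h' => h (hα.2 i x y h')
  refine mem_of_separates_pairs T hcont hα.1 (fun x y hx hy => ?_) (fun x y hx hy => ?_)
    (fun x y hx hy => ?_)
  · simpa [S3.mem_rel_zero_iff] using wit 0 x y (by simp [S3.mem_rel_zero_iff, hx, hy])
  · simpa [S3.mem_rel_one_iff] using wit 1 x y (by simp [S3.mem_rel_one_iff, hx, hy])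
  · obtain ⟨t, ht, h⟩ := wit 2 x y (by simp [S3.mem_rel_two_iff, hx, hy])
    rw [S3.mem_rel_two_iff] at h
    by_cases htx : t x = 1
    · exact ⟨t, ht, htx, fun hty => h (iff_of_true htx hty)⟩
    · have hty : t y = 1 := by
        by_contra hty
        exact h (iff_of_false htx hty)
      -- The relation `r3` is symmetric, so the witness may separate the wrong way round; adding `1`
      -- flips the field component.
      exact ⟨1 + t, add_mem (one_mem T) ht, (S3.one_add_eq_one_iff _).2 htx,
        fun h' => (S3.one_add_eq_one_iff _).1 h' hty⟩

end Interpolation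

/-! ### Duality and injectivity -/

/-- Each homomorphism law is an equation between finitely many coordinates, hence a closed
condition; this makes `D A` compact. -/
theorem isClosedEmbedding_D (A : Type u) [Semiring A] :
    Topology.IsClosedEmbedding (X := D A) (fun (x : A →+* S3) (a : A) => x a) := by
  refine ⟨⟨⟨rfl⟩, fun x y h => RingHom.ext fun a => congrFun h a⟩, ?_⟩
  have : Set.range (fun (x : A →+* S3) (a : A) => x a) =
      {g | g 0 = 0} ∩ {g | g 1 = 1} ∩ (⋂ a, ⋂ b, {g | g (a + b) = g a + g b}) ∩
        ⋂ a, ⋂ b, {g | g (a * b) = g a * g b} := by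
    ext g
    simp only [Set.mem_range, Set.mem_inter_iff, Set.mem_iInter, Set.mem_ofPred_eq]
    constructor
    · rintro ⟨x, rfl⟩
      exact ⟨⟨⟨map_zero x, map_one x⟩, map_add x⟩, map_mul x⟩
    · rintro ⟨⟨⟨h0, h1⟩, ha⟩, hm⟩
      exact ⟨{ toFun := g, map_zero' := h0, map_one' := h1, map_add' := ha, map_mul' := hm }, rfl⟩
  change IsClosed (Set.range (fun (x : A →+* S3) (a : A) => x a))
  rw [this]
  refine ((IsClosed.inter ?_ ?_).inter ?_).inter ?_
  · exact isClosed_eq (continuous_apply _) continuous_const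
  · exact isClosed_eq (continuous_apply _) continuous_const
  · exact isClosed_iInter fun a => isClosed_iInter fun b =>
      isClosed_eq (continuous_apply _) ((continuous_apply a).add (continuous_apply b))
  · exact isClosed_iInter fun a => isClosed_iInter fun b =>
      isClosed_eq (continuous_apply _) ((continuous_apply a).mul (continuous_apply b))

instance (A : Type u) [Semiring A] : CompactSpace (D A) :=
  (isClosedEmbedding_D A).compactSpace

theorem e_injective {A : Type u} [Semiring A] (hA : InISP A) : Function.Injective (e A) := by
  obtain ⟨ι, f, hf⟩ := hA
  intro a b hab
  refine hf (funext fun j => ?_)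
  exact congrFun (congrArg Subtype.val hab)
    (((Pi.evalRingHom (fun _ : ι => S3) j).comp f : A →+* S3) : D A)

/-- The relations on `D A` are pointwise, so a failure occurs at some `a : A`, and the evaluation at
`a` witnesses it. -/
theorem e_surjective (A : Type u) [Semiring A] : Function.Surjective (e A) := by
  rintro ⟨α, hα⟩
  obtain ⟨a, ha⟩ := hα.mem_of_reflects ((E (D A)).subtype.comp (e A)).rangeS
    (by rintro _ ⟨a, rfl⟩; exact (e A a).2.1)
    (fun i x y h => by
      obtain ⟨a, ha⟩ := not_forall.1 h
      exact ⟨_, ⟨a, rfl⟩, ha⟩)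
  exact ⟨a, Subtype.ext ha⟩

theorem yieldsDuality : YieldsDuality.{u} :=
  fun A _ hA => ⟨e_injective hA, e_surjective A⟩

theorem injectiveInChi : InjectiveInChi.{u} := by
  intro X Y _ _ _ _ hX hY φ hφ α hα
  obtain ⟨ι, -, g, hg⟩ := hY
  have : CompactSpace X := (hg.1.comp hφ.1).compactSpace
  let restrict : (Y → S3) →+* (X → S3) := RingHom.pi fun x => Pi.evalRingHom _ (φ x)
  obtain ⟨β, hβ, h⟩ := hα.mem_of_reflects ((E Y).map restrict)
    (by rintro _ ⟨β, hβ, rfl⟩; exact hβ.1.comp hφ.1.continuous)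
    (fun i x y h => by
      rw [hφ.2, hg.2] at h
      obtain ⟨j, hj⟩ := not_forall.1 h
      -- A coordinate of the embedding of `Y` into a power is a morphism on `Y`; its restriction to
      -- `X` is the witness.
      exact ⟨_, ⟨fun z => g z j, ⟨(continuous_apply j).comp hg.1.continuous,
        fun i x y hxy => (hg.2 i x y).1 hxy j⟩, rfl⟩, hj⟩)
  exact ⟨β, hβ, h⟩

/-! ### The substructure `{0, 1}` -/

/-- For a term function `σ` (more generally on pairs in `r₁`), the value `σ(h)` in terms of `σ(0)`
and `σ(1)`: its field component is that of `σ(0)`, its lattice component that of `σ(1)`. -/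
def glue (a b : S3) : S3 :=
  if a = 1 then 1 else if b = 0 then 0 else .half

/-- The two component maps are homomorphisms; on `r1` the glued pair is never the missing pair
`(1,0)`, so `glue` is a homomorphism from `r1` to `S3`. -/
theorem glue_add {a b c d : S3} (h : TriRel.rel 0 a b) (h' : TriRel.rel 0 c d) :
    glue (a + c) (b + d) = glue a b + glue c d := by
  rw [S3.mem_rel_zero_iff] at h h'
  revert a b c d
  decide

theorem glue_mul {a b c d : S3} (h : TriRel.rel 0 a b) (h' : TriRel.rel 0 c d) :
    glue (a * c) (b * d) = glue a b * glue c d := by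
  rw [S3.mem_rel_zero_iff] at h h'
  revert a b c d
  decide

theorem termFunctions_half {σ : (Fin 1 → S3) → S3} (hσ : σ ∈ termFunctions 1) :
    TriRel.rel 0 (σ ![0]) (σ ![1]) ∧ σ ![.half] = glue (σ ![0]) (σ ![1]) := by
  induction hσ using Subsemiring.closure_induction with
  | mem t ht =>
    obtain ⟨k, rfl⟩ := ht
    fin_cases k
    exact ⟨(S3.mem_rel_zero_iff _ _).2 (by decide), by decide⟩
  | zero => exact ⟨rel_zero 0, by decide⟩
  | one => exact ⟨rel_one 0, by decide⟩
  | add s t _ _ hs ht =>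
    refine ⟨rel_add 0 hs.1 ht.1, ?_⟩
    change s _ + t _ = glue (s _ + t _) (s _ + t _)
    rw [glue_add hs.1 ht.1, hs.2, ht.2]
  | mul s t _ _ hs ht =>
    refine ⟨rel_mul 0 hs.1 ht.1, ?_⟩
    change s _ * t _ = glue (s _ * t _) (s _ * t _)
    rw [glue_mul hs.1 ht.1, hs.2, ht.2]

theorem half_notMem : ![S3.half] ∉ ({![0], ![1]} : Set (Fin 1 → S3)) := by
  rintro (h | h) <;> exact absurd (congrFun h 0) (by decide)

theorem not_termSeparates :
    ¬ TermSeparates ({![0], ![1]} : Set (Fin 1 → S3)) ![S3.half] := by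
  rintro ⟨σ, hσ, τ, hτ, heq, hne⟩
  apply hne
  rw [(termFunctions_half hσ).2, (termFunctions_half hτ).2, heq (Or.inl rfl), heq (Or.inr rfl)]

/-- The substructure `{0, 1}`, in an arbitrary universe. -/
def ZeroOne : Type u := ULift.{u} {s : S3 // s ≠ .half}

namespace ZeroOne

instance : TopologicalSpace ZeroOne := ⊥

instance : DiscreteTopology ZeroOne := ⟨rfl⟩

/-- The inclusion into `S`. -/
def val (x : ZeroOne.{u}) : S3 := x.down.1

theorem val_injective : Function.Injective val :=
  Subtype.val_injective.comp ULift.down_injective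

instance : Finite ZeroOne := Finite.of_injective val val_injective

instance : TriRel ZeroOne where
  rel i x y := TriRel.rel i x.val y.val

/-- The point `0`. -/
def bot : ZeroOne.{u} := ⟨⟨0, by decide⟩⟩

/-- The point `1`. -/
def top : ZeroOne.{u} := ⟨⟨1, by decide⟩⟩

theorem eq_bot_or_eq_top (x : ZeroOne.{u}) : x = bot ∨ x = top := by
  obtain ⟨⟨x, hx⟩⟩ := x
  cases x
  · exact Or.inl rfl
  · exact absurd rfl hx
  · exact Or.inr rfl

theorem isMorphism_val : IsMorphism (val : ZeroOne.{u} → S3) :=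
  ⟨continuous_of_discreteTopology, fun _ _ _ h => h⟩

theorem inChi : InChi ZeroOne.{u} := by
  refine ⟨PUnit, inferInstance, fun x _ => x.val, ?_, fun i x y => ⟨fun h _ => h, fun h => h ⟨⟩⟩⟩
  exact Topology.IsClosedEmbedding.of_continuous_injective_isClosedMap
    continuous_of_discreteTopology
    (fun x y h => val_injective (congrFun h ⟨⟩)) fun s _ => (s.toFinite.image _).isClosed

theorem rel_bot_top {α : ZeroOne.{u} → S3} (hα : IsMorphism α) :
    TriRel.rel 0 (α bot) (α top) :=
  hα.2 0 _ _ ((S3.mem_rel_zero_iff _ _).2 (by decide))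

/-- The homomorphism `E({0, 1}) → S` that is not an evaluation at `0` or `1`. -/
def glueHom : E ZeroOne.{u} →+* S3 where
  toFun α := glue (α.1 bot) (α.1 top)
  map_zero' := by change glue 0 0 = 0; decide
  map_one' := by change glue 1 1 = 1; decide
  map_add' α β := glue_add (rel_bot_top α.2) (rel_bot_top β.2)
  map_mul' α β := glue_mul (rel_bot_top α.2) (rel_bot_top β.2)

/-- Evaluated at the inclusion, the homomorphisms `eps _ bot`, `glueHom` and `eps _ top` give `0`,
`h` and `1`, so the double dual has at least three points, whereas `ZeroOne` has only two. -/
theorem not_surjective (f : ZeroOne.{u} → D (E ZeroOne.{u})) : ¬ Function.Surjective f := by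
  intro hf
  let incl : E ZeroOne.{u} := ⟨val, isMorphism_val⟩
  let ev : D (E ZeroOne.{u}) → S3 := fun x : E ZeroOne.{u} →+* S3 => x incl
  have hev : ∀ s : S3, ∃ x, ev (f x) = s := by
    intro s
    have : ∃ y, ev y = s := by
      cases s
      · exact ⟨eps _ bot, rfl⟩
      · exact ⟨glueHom, by change glue 0 1 = S3.half; decide⟩
      · exact ⟨eps _ top, rfl⟩
    obtain ⟨y, hy⟩ := this
    obtain ⟨x, rfl⟩ := hf y
    exact ⟨x, hy⟩
  have two : ∀ s : S3, s = ev (f bot) ∨ s = ev (f top) := by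
    intro s
    obtain ⟨x, rfl⟩ := hev s
    rcases eq_bot_or_eq_top x with rfl | rfl
    · exact Or.inl rfl
    · exact Or.inr rfl
  generalize ev (f bot) = a, ev (f top) = b at two
  revert a b
  decide

theorem not_isStrIso (f : ZeroOne.{u} → D (E ZeroOne.{u})) : ¬ IsStrIso f :=
  fun h => not_surjective f h.1.surjective

end ZeroOne

theorem not_yieldsFullDuality : ¬ YieldsFullDuality.{u} :=
  fun h => ZeroOne.not_isStrIso _ (h.2 ZeroOne ZeroOne.inChi)

end BoolSR

/-- The duality yielded by `⟨S; {r₁, r₂, r₃}, 𝒯⟩` is neither full nor strong. -/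
theorem theorem4p1 :
    -- the structure yields a duality and is injective in `χ`
    BoolSR.YieldsDuality.{u} ∧ BoolSR.InjectiveInChi.{u} ∧
    -- this duality is neither full nor strong
    ¬ BoolSR.YieldsFullDuality.{u} ∧ ¬ BoolSR.YieldsStrongDuality.{u} ∧
    -- some object of `χ` is not isomorphic to its double dual by any map whatsoever
    (∃ (X : Type u) (_ : TopologicalSpace X) (_ : BoolSR.TriRel X), BoolSR.InChi X ∧
      ¬ ∃ f : X → BoolSR.D (BoolSR.E X), BoolSR.IsStrIso f) ∧
    -- finite term closure fails, namely for `n = 1`, `X = {0, 1}` and `y = h`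
    ¬ BoolSR.FiniteTermClosure ∧
    (![BoolSR.S3.half] ∉ ({![0], ![1]} : Set (Fin 1 → BoolSR.S3)) ∧
      ¬ BoolSR.TermSeparates ({![0], ![1]} : Set (Fin 1 → BoolSR.S3)) ![BoolSR.S3.half]) :=
  ⟨BoolSR.yieldsDuality, BoolSR.injectiveInChi, BoolSR.not_yieldsFullDuality,
    fun h => BoolSR.not_yieldsFullDuality h.1,
    ⟨BoolSR.ZeroOne, inferInstance, inferInstance, BoolSR.ZeroOne.inChi,
      fun ⟨f, hf⟩ => BoolSR.ZeroOne.not_isStrIso f hf⟩,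
    fun h => BoolSR.not_termSeparates (h 1 _ _ BoolSR.half_notMem),
    BoolSR.half_notMem, BoolSR.not_termSeparates⟩
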